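/- **Setting.** Let $p\ge 3$, $q\ge 1$, $D=p+q$, and let $M_D(p,q)$ be flat pseudo-Euclidean space. Lower case indices run over the $4$ coordinates of an open chart domain $U$ of space-time, capital indices over the $D-4$ normal directions; $g_{AB}=g^{AB}=\epsilon_A\delta_{AB}$ with $p-3$ signs $+1$ and $q-1$ signs $-1$; $[\,\cdot\,]$ on indices is antisymmetrization with factor $\tfrac12$, acting on the two indices of the same kind next to the brackets. Let $g_{ij}$ be a smooth metric on $U$ of signature $(3,1)$ with Levi-Civita connection $\nabla$ and Riemann tensor $R_{ijkl}=g_{in}(\partial_k\Gamma^n_{lj}-\partial_l\Gamma^n_{kj}+\Gamma^n_{ks}\Gamma^s_{lj}-\Gamma^n_{ls}\Gamma^s_{kj})$; let $b_{ijA}=b_{jiA}$ (extrinsic curvature) and $A_{iAB}=-A_{iBA}$ (twisting vector) be smooth. In the Clifford algebra with generators $E^A$, $\tfrac12(E^AE^B+E^BE^A)=g^{AB}$, put $L^{AB}=\tfrac18[E^A,E^B]$, $b_{ij}=b_{ijA}E^A$, $A_i=A_{iAB}L^{AB}$, $D_iX=\nabla_iX-[A_i,X]$ (with $\nabla_iE^A=0$)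 and $F_{ij}=-(\nabla_iA_j-\nabla_jA_i-[A_i,A_j])$. The Gauss–Weingarten equations for tangent fields $T_i$ and normal fields $N_A$ are $$\nabla_jT_i=g^{MN}b_{ijM}N_N,\qquad \nabla_kN_A=-g^{mn}b_{kmA}T_n+g^{MN}A_{kAM}N_N .$$ A connection is *involutive* on fields $X_k$ if $[\mathcal D_i,\mathcal D_j]X_k=\phi^l_{ijk}X_l$ for some functions $\phi^l_{ijk}$. The Codazzi equation is $D_{[j}b_{k]i}=0$. **Lemma 1.** (a) $(D_kX)_M=\nabla_kX_M-g^{PQ}A_{kMP}X_Q$ for $X=X_ME^M$, and likewise $(D_kb_{ij})_M=\nabla_kb_{ijM}-g^{PQ}A_{kMP}b_{ijQ}$; hence the Codazzi equation is $(D_jb_{ki})_M=(D_kb_{ji})_M$ for all $M$. Moreover $[D_i,D_j]X=[F_{ij},X]$ for every $X=X_ME^M$ with $C^2$ components. (b) Let $T_i,N_A:U\to\mathbb R^D$ be smooth, pointwise linearly independent, and satisfy the Gauss–Weingarten equations, where $\mathbb R^D$-valued functions are differentiated with any ambient connection $\partial_k+\Omega_k$ (in particular with the flat one, $\Omega=0$).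 Then $$[\nabla_k,\nabla_j]T_i=2g^{MN}(D_{[k}b_{j]i})_MN_N-2g^{mn}g^{MN}b_{i[jM}b_{k]mN}T_n,$$ $$[D_i,D_j]N_A=2g^{mn}g^{MN}b_{m[iA}b_{j]nM}N_N-2g^{mn}(D_{[i}b_{j]m})_AT_n .$$ The Levi-Civita connection is involutive on the $T_i$ if and only if the Codazzi equation holds, and the twisting connection is involutive on the $N_A$ if and only if the Codazzi equation holds. (c) Let $Y:U\to M_D(p,q)$ be smooth and isometric, with smooth normal fields $N_A$, $\langle N_A,N_B\rangle=g_{AB}$, such that the Gauss–Weingarten equations hold with $T_i=\partial_iY$ and the flat derivative. Then the Levi-Civita connection (on the $\partial_iY$) and the twisting connection (on the $N_A$) are involutive if and only if the Codazzi equation holds. Once it holds, $$[\nabla_k,\nabla_j]\partial_iY=-2g^{mn}g^{MN}b_{i[jM}b_{k]mN}\,\partial_nY,\qquad [D_i,D_j]N_A=2g^{mn}g^{MN}b_{m[iA}b_{j]nM}N_N,$$ and the Gauss and Ricci equations follow: $$R_{ijkl}=g^{MN}(b_{ikM}b_{jlN}-b_{ilM}b_{jkN})=\tfrac12(b_{ik}b_{jl}+b_{jl}b_{ik})-\tfrac12(b_{il}b_{jk}+b_{jk}b_{il}),$$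 $$F_{ij}=2g^{mn}b_{m[iA}b_{j]nB}L^{AB}=\tfrac12g^{mn}b_{m[i}b_{j]n}.$$ -/

import Mathlib

open scoped ContDiff

/-! ### Index conventions

`Coord` is the coordinate space of a chart of space-time, lower case Latin indices are in `Fin 4`.
`Ambient p q` is the pseudo-Euclidean space `M_D(p,q)`, `D = p + q`, in Cartesian coordinates.
Capital Latin indices are in `NIdx p q`: there are `p - 3` positive and `q - 1` negative normals
(always used with `3 ≤ p`, `1 ≤ q`). -/

abbrev Coord : Type := Fin 4 → ℝ

abbrev Ambient (p q : ℕ) : Type := Fin p ⊕ Fin q → ℝ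

abbrev NIdx (p q : ℕ) : Type := Fin (p - 3) ⊕ Fin (q - 1)

noncomputable section

/-- The flat metric of `M_D(p,q)`. -/
def ambientInner {p q : ℕ} (u v : Ambient p q) : ℝ :=
  ∑ a, u (Sum.inl a) * v (Sum.inl a) - ∑ a, u (Sum.inr a) * v (Sum.inr a)

/-- `ε_A = ±1`; the normal metric is `g_AB = g^AB = ε_A δ_AB`. -/
def eps {p q : ℕ} : NIdx p q → ℝ := Sum.elim (fun _ => 1) (fun _ => -1)

/-- Partial derivative `∂_k f`. -/
def pd {V : Type} [NormedAddCommGroup V] [NormedSpace ℝ V]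
    (k : Fin 4) (f : Coord → V) (x : Coord) : V :=
  fderiv ℝ f x (Pi.single k 1)

/-- A symmetric bilinear form on `ℝ⁴` of signature `(3,1)`. -/
def IsLorentzian (G : Matrix (Fin 4) (Fin 4) ℝ) : Prop :=
  ∃ P : Matrix (Fin 4) (Fin 4) ℝ, IsUnit P.det ∧
    G = P.transpose * Matrix.diagonal ![1, 1, 1, -1] * P

/-- Christoffel symbol `Γ^n_ij` of the Levi-Civita connection of `g`. -/
def christoffel (g : Coord → Matrix (Fin 4) (Fin 4) ℝ) (n i j : Fin 4) (x : Coord) : ℝ :=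
  (1 / 2) * ∑ m, (g x)⁻¹ n m *
    (pd i (fun y => g y m j) x + pd j (fun y => g y m i) x - pd m (fun y => g y i j) x)

/-- Riemann tensor `R_ijkl = g_in (∂_k Γ^n_lj - ∂_l Γ^n_kj + Γ^n_ks Γ^s_lj - Γ^n_ls Γ^s_kj)`. -/
def riemann (g : Coord → Matrix (Fin 4) (Fin 4) ℝ) (i j k l : Fin 4) (x : Coord) : ℝ :=
  ∑ n, g x i n *
    (pd k (christoffel g n l j) x - pd l (christoffel g n k j) x
      + ∑ s, (christoffel g n k s x * christoffel g s l j x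
        - christoffel g n l s x * christoffel g s k j x))

/-- Metric `g_ij`, extrinsic curvature `b_ijA` and twisting vector `A_iAB` on a chart domain `U`. -/
structure IsSpacetimeData {p q : ℕ} (U : Set Coord) (g : Coord → Matrix (Fin 4) (Fin 4) ℝ)
    (b : Fin 4 → Fin 4 → NIdx p q → Coord → ℝ)
    (A : Fin 4 → NIdx p q → NIdx p q → Coord → ℝ) : Prop where
  smooth_g : ∀ i j, ContDiffOn ℝ ∞ (fun x => g x i j) U
  smooth_b : ∀ i j M, ContDiffOn ℝ ∞ (b i j M) U
  smooth_A : ∀ i M N, ContDiffOn ℝ ∞ (A i M N) U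
  lorentzian : ∀ x ∈ U, IsLorentzian (g x)
  symm_b : ∀ x ∈ U, ∀ i j M, b i j M x = b j i M x
  antisymm_A : ∀ x ∈ U, ∀ i M N, A i M N x = - A i N M x

/-! ### Covariant derivatives of frames

`nab k s` is the derivative in the direction `k` of an ambient-valued function `s` on the chart;
it is `pd k s` when the ambient space is flat. -/

section Frames

variable {V : Type} [NormedAddCommGroup V] [NormedSpace ℝ V]

/-- The covariant derivative `∂_k + Ω_k` of an ambient connection along the chart. -/
def ambientDeriv (Ω : Fin 4 → Coord → (V →L[ℝ] V)) (k : Fin 4) (s : Coord → V) (x : Coord) : V :=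
  pd k s x + Ω k x (s x)

/-- `∇_j T_i`. -/
def lcDeriv (nab : Fin 4 → (Coord → V) → Coord → V) (g : Coord → Matrix (Fin 4) (Fin 4) ℝ)
    (T : Fin 4 → Coord → V) (j i : Fin 4) (x : Coord) : V :=
  nab j (T i) x - ∑ n, christoffel g n j i x • T n x

/-- `∇_k ∇_j T_i`. -/
def lcDeriv2 (nab : Fin 4 → (Coord → V) → Coord → V) (g : Coord → Matrix (Fin 4) (Fin 4) ℝ)
    (T : Fin 4 → Coord → V) (k j i : Fin 4) (x : Coord) : V :=
  nab k (lcDeriv nab g T j i) x - ∑ n, christoffel g n k j x • lcDeriv nab g T n i x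
    - ∑ n, christoffel g n k i x • lcDeriv nab g T j n x

/-- `[∇_k, ∇_j] T_i`. -/
def lcComm (nab : Fin 4 → (Coord → V) → Coord → V) (g : Coord → Matrix (Fin 4) (Fin 4) ℝ)
    (T : Fin 4 → Coord → V) (k j i : Fin 4) (x : Coord) : V :=
  lcDeriv2 nab g T k j i x - lcDeriv2 nab g T j k i x

/-- Components `(D_k X)_M = ∇_k X_M - g^PQ A_kMP X_Q` of the twisting covariant derivative. -/
def twDeriv {p q : ℕ} (nab : Fin 4 → (Coord → V) → Coord → V)
    (A : Fin 4 → NIdx p q → NIdx p q → Coord → ℝ)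
    (X : NIdx p q → Coord → V) (k : Fin 4) (M : NIdx p q) (x : Coord) : V :=
  nab k (X M) x - ∑ P, (eps P * A k M P x) • X P x

/-- Components `(D_i D_j X)_M`; the index `j` is differentiated with the Levi-Civita connection. -/
def twDeriv2 {p q : ℕ} (nab : Fin 4 → (Coord → V) → Coord → V)
    (g : Coord → Matrix (Fin 4) (Fin 4) ℝ)
    (A : Fin 4 → NIdx p q → NIdx p q → Coord → ℝ)
    (X : NIdx p q → Coord → V) (i j : Fin 4) (M : NIdx p q) (x : Coord) : V :=
  twDeriv nab A (fun P => twDeriv nab A X j P) i M x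
    - ∑ n, christoffel g n i j x • twDeriv nab A X n M x

/-- Components `([D_i, D_j] X)_M`. -/
def twComm {p q : ℕ} (nab : Fin 4 → (Coord → V) → Coord → V)
    (g : Coord → Matrix (Fin 4) (Fin 4) ℝ)
    (A : Fin 4 → NIdx p q → NIdx p q → Coord → ℝ)
    (X : NIdx p q → Coord → V) (i j : Fin 4) (M : NIdx p q) (x : Coord) : V :=
  twDeriv2 nab g A X i j M x - twDeriv2 nab g A X j i M x

/-- Involutivity of a connection with respect to the fields `X_κ`: its commutators satisfy
`[D_i, D_j] X_κ = φ^l_ijκ X_l` for some functions `φ^l_ijκ`. -/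
def IsInvolutive {K : Type} [Fintype K] (U : Set Coord)
    (comm : Fin 4 → Fin 4 → K → Coord → V) (X : K → Coord → V) : Prop :=
  ∃ φ : K → Fin 4 → Fin 4 → K → Coord → ℝ,
    ∀ x ∈ U, ∀ i j κ, comm i j κ x = ∑ l, φ l i j κ x • X l x

/-- The Gauss-Weingarten equations
`∇_j T_i = g^MN b_ijM N_N` and `∇_k N_A = - g^mn b_kmA T_n + g^MN A_kAM N_N`. -/
def GaussWeingarten {p q : ℕ} (U : Set Coord) (nab : Fin 4 → (Coord → V) → Coord → V)
    (g : Coord → Matrix (Fin 4) (Fin 4) ℝ)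
    (b : Fin 4 → Fin 4 → NIdx p q → Coord → ℝ)
    (A : Fin 4 → NIdx p q → NIdx p q → Coord → ℝ)
    (T : Fin 4 → Coord → V) (N : NIdx p q → Coord → V) : Prop :=
  ∀ x ∈ U,
    (∀ i j, lcDeriv nab g T j i x = ∑ M, (eps M * b i j M x) • N M x) ∧
    (∀ k B, nab k (N B) x =
      - ∑ n, (∑ m, (g x)⁻¹ m n * b k m B x) • T n x + ∑ M, (eps M * A k B M x) • N M x)

/-- Smooth fields `T_i`, `N_A` along `U` which are linearly independent at each point. -/
structure IsFrame {p q : ℕ} (U : Set Coord)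
    (T : Fin 4 → Coord → V) (N : NIdx p q → Coord → V) : Prop where
  smooth_T : ∀ i, ContDiffOn ℝ ∞ (T i) U
  smooth_N : ∀ M, ContDiffOn ℝ ∞ (N M) U
  indep : ∀ x ∈ U, LinearIndependent ℝ
    (Sum.elim (fun i => T i x) (fun M => N M x) : Fin 4 ⊕ NIdx p q → V)

end Frames

/-- `Y : U → M_D(p,q)` is isometric with orthonormal normal frame `N_A`, and `b`, `A` are its
extrinsic curvature and twisting vector, that is, the Gauss-Weingarten equations hold with the
flat derivative and `T_i = ∂_i Y`. -/
structure IsEmbeddedSpacetime {p q : ℕ} (U : Set Coord) (g : Coord → Matrix (Fin 4) (Fin 4) ℝ)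
    (b : Fin 4 → Fin 4 → NIdx p q → Coord → ℝ)
    (A : Fin 4 → NIdx p q → NIdx p q → Coord → ℝ)
    (Y : Coord → Ambient p q) (N : NIdx p q → Coord → Ambient p q) : Prop where
  smooth_Y : ContDiffOn ℝ ∞ Y U
  smooth_N : ∀ M, ContDiffOn ℝ ∞ (N M) U
  isometric : ∀ x ∈ U, ∀ i j, ambientInner (pd i Y x) (pd j Y x) = g x i j
  normal : ∀ x ∈ U, ∀ i M, ambientInner (pd i Y x) (N M x) = 0
  orthonormal : ∀ x ∈ U, ∀ M P, ambientInner (N M x) (N P x) = if M = P then eps M else 0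
  gaussWeingarten : GaussWeingarten U pd g b A (fun i => pd i Y) N

/-! ### The Clifford algebra of the normal metric -/

/-- The Clifford algebra of `g_AB`. -/
abbrev NCliff (p q : ℕ) : Type :=
  CliffordAlgebra (QuadraticMap.weightedSumSquares ℝ (eps : NIdx p q → ℝ))

/-- Clifford generators `E^A`, with `(E^A E^B + E^B E^A) / 2 = g^AB`. -/
def cE {p q : ℕ} (M : NIdx p q) : NCliff p q :=
  CliffordAlgebra.ι (QuadraticMap.weightedSumSquares ℝ (eps : NIdx p q → ℝ)) (Pi.single M 1)

/-- The commutator of the Clifford algebra. -/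
def cComm {p q : ℕ} (u v : NCliff p q) : NCliff p q := u * v - v * u

/-- Lie algebra generators `L^AB` of `SO(p-3,q-1)`, with `8 L^AB = [E^A, E^B]`. -/
def cL {p q : ℕ} (M P : NIdx p q) : NCliff p q := (1 / 8 : ℝ) • cComm (cE M) (cE P)

/-- `X = X_A E^A`. -/
def cVec {p q : ℕ} (X : NIdx p q → ℝ) : NCliff p q := ∑ M, X M • cE M

/-- `A_i = A_iAB L^AB`. -/
def cA {p q : ℕ} (A : Fin 4 → NIdx p q → NIdx p q → Coord → ℝ) (i : Fin 4) (x : Coord) :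
    NCliff p q := ∑ M, ∑ P, A i M P x • cL M P

/-- `b_ij = b_ijA E^A`. -/
def cb {p q : ℕ} (b : Fin 4 → Fin 4 → NIdx p q → Coord → ℝ) (i j : Fin 4) (x : Coord) :
    NCliff p q := cVec (fun M => b i j M x)

/-- `∇_k b_ijM` (Levi-Civita connection). -/
def covb {p q : ℕ} (g : Coord → Matrix (Fin 4) (Fin 4) ℝ)
    (b : Fin 4 → Fin 4 → NIdx p q → Coord → ℝ) (k i j : Fin 4) (M : NIdx p q) (x : Coord) : ℝ :=
  pd k (b i j M) x - ∑ n, christoffel g n k i x * b n j M x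
    - ∑ n, christoffel g n k j x * b i n M x

/-- `D_k b_ij = ∇_k b_ij - [A_k, b_ij]`, in the Clifford algebra; here `∇_k E^A = 0`. -/
def twb {p q : ℕ} (g : Coord → Matrix (Fin 4) (Fin 4) ℝ)
    (b : Fin 4 → Fin 4 → NIdx p q → Coord → ℝ)
    (A : Fin 4 → NIdx p q → NIdx p q → Coord → ℝ) (k i j : Fin 4) (x : Coord) : NCliff p q :=
  cVec (fun M => covb g b k i j M x) - cComm (cA A k x) (cb b i j x)

/-- Components `∇_k b_ijM - g^PQ A_kMP b_ijQ` of `D_k b_ij`. -/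
def twbComp {p q : ℕ} (g : Coord → Matrix (Fin 4) (Fin 4) ℝ)
    (b : Fin 4 → Fin 4 → NIdx p q → Coord → ℝ)
    (A : Fin 4 → NIdx p q → NIdx p q → Coord → ℝ) (k i j : Fin 4) (M : NIdx p q) (x : Coord) : ℝ :=
  covb g b k i j M x - ∑ P, eps P * A k M P x * b i j P x

/-- The Codazzi equation `D_[j b_k]i = 0`. -/
def Codazzi {p q : ℕ} (U : Set Coord) (g : Coord → Matrix (Fin 4) (Fin 4) ℝ)
    (b : Fin 4 → Fin 4 → NIdx p q → Coord → ℝ)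
    (A : Fin 4 → NIdx p q → NIdx p q → Coord → ℝ) : Prop :=
  ∀ x ∈ U, ∀ i j k, (1 / 2 : ℝ) • (twb g b A j k i x - twb g b A k j i x) = 0

/-- Twisting curvature `F_ij = -(∇_i A_j - ∇_j A_i - [A_i, A_j])`; the Christoffel symbols cancel
in `∇_i A_j - ∇_j A_i`. -/
def twCurv {p q : ℕ} (A : Fin 4 → NIdx p q → NIdx p q → Coord → ℝ) (i j : Fin 4) (x : Coord) :
    NCliff p q :=
  - ((∑ M, ∑ P, (pd i (A j M P) x - pd j (A i M P) x) • cL M P) - cComm (cA A i x) (cA A j x))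

/-- `g^mn (b_miM b_jnP - b_mjM b_inP)`, that is, `2 g^mn b_m[iM b_j]nP`. -/
def ricciQuad {p q : ℕ} (g : Coord → Matrix (Fin 4) (Fin 4) ℝ)
    (b : Fin 4 → Fin 4 → NIdx p q → Coord → ℝ) (i j : Fin 4) (M P : NIdx p q) (x : Coord) : ℝ :=
  ∑ m, ∑ n, (g x)⁻¹ m n * (b m i M x * b j n P x - b m j M x * b i n P x)

/-- `g^MN (b_ikM b_jlN - b_ilM b_jkN)`. -/
def gaussQuad {p q : ℕ} (b : Fin 4 → Fin 4 → NIdx p q → Coord → ℝ)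
    (i j k l : Fin 4) (x : Coord) : ℝ :=
  ∑ M, eps M * (b i k M x * b j l M x - b i l M x * b j k M x)

/-- The Gauss equation, in components and in the Clifford algebra. -/
def GaussEq {p q : ℕ} (U : Set Coord) (g : Coord → Matrix (Fin 4) (Fin 4) ℝ)
    (b : Fin 4 → Fin 4 → NIdx p q → Coord → ℝ) : Prop :=
  ∀ x ∈ U, ∀ i j k l,
    riemann g i j k l x = gaussQuad b i j k l x ∧
    riemann g i j k l x • (1 : NCliff p q) =
      (1 / 2 : ℝ) • (cb b i k x * cb b j l x + cb b j l x * cb b i k x)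
        - (1 / 2 : ℝ) • (cb b i l x * cb b j k x + cb b j k x * cb b i l x)

/-- The Ricci equation `F_ij = 2 g^mn b_m[iA b_j]nB L^AB = (1/2) g^mn b_m[i b_j]n`. -/
def RicciEq {p q : ℕ} (U : Set Coord) (g : Coord → Matrix (Fin 4) (Fin 4) ℝ)
    (b : Fin 4 → Fin 4 → NIdx p q → Coord → ℝ)
    (A : Fin 4 → NIdx p q → NIdx p q → Coord → ℝ) : Prop :=
  ∀ x ∈ U, ∀ i j,
    twCurv A i j x = ∑ M, ∑ P, ricciQuad g b i j M P x • cL M P ∧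
    twCurv A i j x = (1 / 4 : ℝ) • ∑ m, ∑ n,
      (g x)⁻¹ m n • (cb b m i x * cb b j n x - cb b m j x * cb b i n x)

end

/-! ### Commutators in the Clifford algebra of the normal metric. -/

section NormalClifford

variable {p q : ℕ}

/-! Differentiating the Gauss–Weingarten equations once more, and substituting them again, expands
each commutator in the frame `T`, `N` (`lcComm_eq`, `twComm_eq`). The unwanted coefficients (normal
for `T`, tangential for `N`) are the Codazzi tensor, multiplied by `eps` or raised by the inverse
metric; the others are quadratic in `b`. Only locality and the Leibniz rule of `∂ + Ω` enter, so its
curvature plays no role. Linear independence of the frame and nondegeneracy of the metric then make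
involutivity equivalent to Codazzi.

In the flat case the same commutators can be evaluated a second way: partial derivatives commute,
leaving the Riemann tensor (`lcComm_pd`) and the components of the twisting curvature (`twComm_pd`).
Comparing coefficients of the two evaluations gives Gauss and Ricci.

The Clifford forms rest on two facts: vectors embed injectively (`cVec_injective`), and commutators
with `B_MP L^MP` act on vectors and on bivectors as the matrix `B` does, indices being raised by
`eps` (`cComm_spin_cVec`, `cComm_spin_spin`). -/

/-- The Clifford algebra element `B_MP L^MP`. -/
noncomputable def spin (B : NIdx p q → NIdx p q → ℝ) : NCliff p q :=
  ∑ M, ∑ P, B M P • cL M P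

theorem cVec_eq_ι (X : NIdx p q → ℝ) :
    cVec X = CliffordAlgebra.ι (QuadraticMap.weightedSumSquares ℝ (eps : NIdx p q → ℝ)) X := by
  simp only [cVec, cE, ← map_smul, ← map_sum]
  congr 1
  ext M
  simp [Finset.sum_apply, Pi.single_apply]

/-- The linear isomorphism with the exterior algebra fixes vectors, and there `ι` has a left
inverse. -/
theorem cVec_injective : Function.Injective (cVec : (NIdx p q → ℝ) → NCliff p q) := by
  intro X Y h
  rw [cVec_eq_ι, cVec_eq_ι] at h
  have h' := congrArg (CliffordAlgebra.equivExterior _) h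
  simp only [CliffordAlgebra.equivExterior, CliffordAlgebra.changeFormEquiv_apply,
    CliffordAlgebra.changeForm_ι] at h'
  exact ExteriorAlgebra.ι_leftInverse.injective h'

theorem cVec_sub (X Y : NIdx p q → ℝ) : cVec X - cVec Y = cVec (fun M => X M - Y M) := by
  simp only [cVec, sub_smul, Finset.sum_sub_distrib]

theorem cE_mul_cE_add_swap (M P : NIdx p q) :
    cE M * cE P + cE P * cE M = algebraMap ℝ (NCliff p q) (if M = P then 2 * eps M else 0) := by
  rw [cE, cE, CliffordAlgebra.ι_mul_ι_add_swap]
  congr 1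
  simp only [QuadraticMap.polar, QuadraticMap.weightedSumSquares_apply, ← Finset.sum_sub_distrib]
  have key : ∀ Q : NIdx p q,
      eps Q • ((Pi.single M 1 + Pi.single P 1 : NIdx p q → ℝ) Q *
          (Pi.single M 1 + Pi.single P 1 : NIdx p q → ℝ) Q)
        - eps Q • ((Pi.single M 1 : NIdx p q → ℝ) Q * (Pi.single M 1 : NIdx p q → ℝ) Q)
        - eps Q • ((Pi.single P 1 : NIdx p q → ℝ) Q * (Pi.single P 1 : NIdx p q → ℝ) Q)
        = if Q = M then (if M = P then 2 * eps M else 0) else 0 := by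
    intro Q
    by_cases h1 : Q = M
    · subst h1
      by_cases h2 : Q = P
      · subst h2; simp; ring
      · simp [h2]
    · by_cases h2 : Q = P
      · subst h2; simp [h1]
      · simp [h1, h2]
  simp only [key, Finset.sum_ite_eq', Finset.mem_univ, if_true]

/-- Antisymmetry makes the two orderings in `[E^M, E^P]` contribute equally, turning `1/8` into
`1/4`. -/
theorem spin_eq {B : NIdx p q → NIdx p q → ℝ} (hB : ∀ M P, B M P = -B P M) :
    spin B = (1 / 4 : ℝ) • ∑ M, ∑ P, B M P • (cE M * cE P) := by
  have hswap : ∑ M, ∑ P, B M P • (cE P * cE M) = -∑ M, ∑ P, B M P • (cE M * cE P) := by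
    rw [Finset.sum_comm]
    simp only [← Finset.sum_neg_distrib, ← neg_smul, ← hB]
  calc spin B = (1 / 8 : ℝ) • (∑ M, ∑ P, B M P • (cE M * cE P)
        - ∑ M, ∑ P, B M P • (cE P * cE M)) := by
        simp only [spin, cL, cComm, ← Finset.sum_sub_distrib, ← smul_sub, Finset.smul_sum,
          smul_comm (1 / 8 : ℝ)]
    _ = _ := by rw [hswap, sub_neg_eq_add, ← two_smul ℝ, smul_smul]; norm_num

/-- With `{u, v} = uv + vu`, this is `[uv, w] = u{v, w} - {u, w}v`, where the anticommutators of
generators are scalars. -/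
theorem cComm_cE_mul_cE (M P Q : NIdx p q) :
    cComm (cE M * cE P) (cE Q)
      = (if P = Q then 2 * eps Q else 0) • cE M - (if M = Q then 2 * eps Q else 0) • cE P := by
  have h1 := cE_mul_cE_add_swap P Q
  have h2 := cE_mul_cE_add_swap M Q
  have e1 : (if P = Q then 2 * eps P else 0) = (if P = Q then 2 * eps Q else 0) := by
    split_ifs with h <;> simp [h]
  have e2 : (if M = Q then 2 * eps M else 0) = (if M = Q then 2 * eps Q else 0) := by
    split_ifs with h <;> simp [h]
  rw [e1] at h1
  rw [e2] at h2
  rw [Algebra.smul_def, Algebra.smul_def, Algebra.commutes, ← h1, ← h2, cComm]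
  noncomm_ring

theorem cComm_sum_left {ι : Type*} (s : Finset ι) (u : ι → NCliff p q) (v : NCliff p q) :
    cComm (∑ i ∈ s, u i) v = ∑ i ∈ s, cComm (u i) v := by
  simp only [cComm, Finset.sum_mul, Finset.mul_sum, Finset.sum_sub_distrib]

theorem cComm_sum_right {ι : Type*} (s : Finset ι) (u : NCliff p q) (v : ι → NCliff p q) :
    cComm u (∑ i ∈ s, v i) = ∑ i ∈ s, cComm u (v i) := by
  simp only [cComm, Finset.sum_mul, Finset.mul_sum, Finset.sum_sub_distrib]

theorem cComm_smul_left (c : ℝ) (u v : NCliff p q) : cComm (c • u) v = c • cComm u v := by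
  simp only [cComm, smul_mul_assoc, mul_smul_comm, smul_sub]

theorem cComm_smul_right (c : ℝ) (u v : NCliff p q) : cComm u (c • v) = c • cComm u v := by
  simp only [cComm, smul_mul_assoc, mul_smul_comm, smul_sub]

theorem cComm_mul_right (u v w : NCliff p q) :
    cComm u (v * w) = cComm u v * w + v * cComm u w := by
  simp only [cComm]; noncomm_ring

/-- The normalisation of `L^AB` gives coefficient one here: the factor `1/4` of `spin_eq` meets two
equal contributions with factor `2`. -/
theorem cComm_spin_cE {B : NIdx p q → NIdx p q → ℝ} (hB : ∀ M P, B M P = -B P M)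
    (Q : NIdx p q) : cComm (spin B) (cE Q) = ∑ M, (eps Q * B M Q) • cE M := by
  rw [spin_eq hB, cComm_smul_left, cComm_sum_left]
  simp only [cComm_sum_left, cComm_smul_left, cComm_cE_mul_cE, smul_sub, smul_smul,
    Finset.sum_sub_distrib, smul_ite, ite_smul, zero_smul, smul_zero, Finset.sum_ite_eq',
    Finset.mem_univ, if_true]
  rw [Finset.sum_comm (f := fun M P => if M = Q then (B M P * (2 * eps Q)) • (cE P : NCliff p q) else 0)]
  simp only [Finset.sum_ite_eq', Finset.mem_univ, if_true]
  rw [← smul_sub, ← Finset.sum_sub_distrib, Finset.smul_sum]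
  refine Finset.sum_congr rfl fun M _ => ?_
  rw [← sub_smul, smul_smul, hB Q M]
  congr 1
  ring

theorem cComm_spin_cVec {B : NIdx p q → NIdx p q → ℝ} (hB : ∀ M P, B M P = -B P M)
    (X : NIdx p q → ℝ) :
    cComm (spin B) (cVec X) = cVec (fun M => ∑ P, eps P * B M P * X P) := by
  simp only [cVec, cComm_sum_right, cComm_smul_right, cComm_spin_cE hB, Finset.smul_sum,
    smul_smul, Finset.sum_smul]
  rw [Finset.sum_comm]
  refine Finset.sum_congr rfl fun M _ => Finset.sum_congr rfl fun P _ => ?_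
  rw [mul_comm]

/-- A commutator is a derivation, so `spin B` acts on each factor of `E^M E^P` in turn, and the two
terms form the matrix commutator. This supplies the quadratic term of the twisting curvature. -/
theorem cComm_spin_spin {B C : NIdx p q → NIdx p q → ℝ} (hB : ∀ M P, B M P = -B P M)
    (hC : ∀ M P, C M P = -C P M) :
    cComm (spin B) (spin C)
      = spin (fun M P => ∑ Q, eps Q * (B M Q * C Q P - C M Q * B Q P)) := by
  have hBC : ∀ M P, (∑ Q, eps Q * (B M Q * C Q P - C M Q * B Q P))
      = -(∑ Q, eps Q * (B P Q * C Q M - C P Q * B Q M)) := by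
    intro M P
    rw [← Finset.sum_neg_distrib]
    refine Finset.sum_congr rfl fun Q _ => ?_
    rw [hB M Q, hC Q P, hC M Q, hB Q P]
    ring
  rw [spin_eq hC, spin_eq hBC, cComm_smul_right]
  congr 1
  simp only [cComm_sum_right, cComm_smul_right, cComm_mul_right, cComm_spin_cE hB, mul_sub,
    Finset.sum_sub_distrib, sub_smul, smul_add, Finset.sum_add_distrib, Finset.sum_mul,
    Finset.mul_sum, Finset.smul_sum, smul_mul_assoc, mul_smul_comm, smul_smul, Finset.sum_smul]
  rw [sub_eq_add_neg]
  congr 1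
  · calc _ = ∑ P, ∑ Q, ∑ M, (C Q P * (eps Q * B M Q)) • (cE M * cE P) := Finset.sum_comm
      _ = ∑ P, ∑ M, ∑ Q, (C Q P * (eps Q * B M Q)) • (cE M * cE P) :=
        Finset.sum_congr rfl fun P _ => Finset.sum_comm
      _ = ∑ M, ∑ P, ∑ Q, (C Q P * (eps Q * B M Q)) • (cE M * cE P) := Finset.sum_comm
      _ = _ := by
        refine Finset.sum_congr rfl fun M _ => Finset.sum_congr rfl fun P _ =>
          Finset.sum_congr rfl fun Q _ => ?_
        congr 1
        ring
  -- The action on the second factor carries `B P Q`; antisymmetry turns it into `-B Q P`.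
  · simp only [← Finset.sum_neg_distrib]
    refine Finset.sum_congr rfl fun M _ => ?_
    rw [Finset.sum_comm]
    refine Finset.sum_congr rfl fun P _ => Finset.sum_congr rfl fun Q _ => ?_
    rw [← neg_smul, hB P Q]
    congr 1
    ring

theorem cVec_mul_cVec (X Y : NIdx p q → ℝ) :
    cVec X * cVec Y = ∑ M, ∑ P, (X M * Y P) • (cE M * cE P) := by
  simp only [cVec, Finset.sum_mul, Finset.mul_sum, smul_mul_assoc, mul_smul_comm, Finset.smul_sum,
    smul_smul]
  rw [Finset.sum_comm]
  simp only [mul_comm (Y _) (X _)]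

theorem cVec_mul_cVec_add_swap (X Y : NIdx p q → ℝ) :
    cVec X * cVec Y + cVec Y * cVec X = (2 * ∑ M, eps M * (X M * Y M)) • (1 : NCliff p q) := by
  rw [cVec_mul_cVec, cVec_mul_cVec Y X,
    Finset.sum_comm (f := fun M P => (Y M * X P) • (cE M * cE P))]
  simp only [← Finset.sum_add_distrib, mul_comm (Y _) (X _), ← smul_add, cE_mul_cE_add_swap,
    Algebra.algebraMap_eq_smul_one, smul_smul, smul_ite, ite_smul, zero_smul, smul_zero,
    Finset.sum_ite_eq, Finset.mem_univ, if_true, Finset.mul_sum, Finset.sum_smul]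
  refine Finset.sum_congr rfl fun M _ => ?_
  congr 1
  ring

end NormalClifford

/-! ### Partial derivatives on an open chart domain. -/

section Calculus

variable {V : Type} [NormedAddCommGroup V] [NormedSpace ℝ V] {U : Set Coord} {x : Coord}

/-- All hypotheses hold on `U` only; openness is what allows such identities to be differentiated.
-/
theorem pd_congr (hU : IsOpen U) (hx : x ∈ U) {f h : Coord → V} (hfh : ∀ y ∈ U, f y = h y)
    (k : Fin 4) : pd k f x = pd k h x := by
  have : f =ᶠ[nhds x] h := Filter.eventuallyEq_of_mem (hU.mem_nhds hx) hfh
  rw [pd, pd, this.fderiv_eq]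

theorem pd_neg (f : Coord → V) (k : Fin 4) : pd k (fun y => -f y) x = -pd k f x := by
  simp only [pd, fderiv_fun_neg, neg_apply]

theorem pd_sub {f h : Coord → V} (hf : DifferentiableAt ℝ f x) (hh : DifferentiableAt ℝ h x)
    (k : Fin 4) : pd k (fun y => f y - h y) x = pd k f x - pd k h x := by
  simp only [pd, fderiv_fun_sub hf hh, sub_apply]

theorem pd_sum {ι : Type*} (s : Finset ι) {f : ι → Coord → V}
    (hf : ∀ i ∈ s, DifferentiableAt ℝ (f i) x) (k : Fin 4) :
    pd k (fun y => ∑ i ∈ s, f i y) x = ∑ i ∈ s, pd k (f i) x := by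
  simp only [pd, fderiv_fun_sum hf, sum_apply]

theorem pd_smul {c : Coord → ℝ} {f : Coord → V} (hc : DifferentiableAt ℝ c x)
    (hf : DifferentiableAt ℝ f x) (k : Fin 4) :
    pd k (fun y => c y • f y) x = pd k c x • f x + c x • pd k f x := by
  simp only [pd, fderiv_fun_smul hc hf, add_apply,
    smul_apply, ContinuousLinearMap.smulRight_apply, add_comm]

theorem pd_mul {c f : Coord → ℝ} (hc : DifferentiableAt ℝ c x)
    (hf : DifferentiableAt ℝ f x) (k : Fin 4) :
    pd k (fun y => c y * f y) x = pd k c x * f x + c x * pd k f x :=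
  pd_smul hc hf k

theorem pd_const (c : V) (k : Fin 4) : pd k (fun _ => c) x = 0 := by
  simp [pd]

theorem pd_const_mul (c : ℝ) {f : Coord → ℝ} (hf : DifferentiableAt ℝ f x) (k : Fin 4) :
    pd k (fun y => c * f y) x = c * pd k f x := by
  rw [pd_mul (differentiableAt_const c) hf, pd_const, zero_mul, zero_add]

theorem pd_sum_smul {ι : Type*} [Fintype ι] {c : ι → Coord → ℝ} {f : ι → Coord → V}
    (hc : ∀ i, DifferentiableAt ℝ (c i) x) (hf : ∀ i, DifferentiableAt ℝ (f i) x) (k : Fin 4) :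
    pd k (fun y => ∑ i, c i y • f i y) x = ∑ i, (pd k (c i) x • f i x + c i x • pd k (f i) x) := by
  rw [pd_sum (f := fun i y => c i y • f i y) _ fun i _ => (hc i).smul (hf i)]
  exact Finset.sum_congr rfl fun i _ => pd_smul (hc i) (hf i) k

theorem ContDiffOn.differentiableAt_of_isOpen {n : ℕ∞ω} {f : Coord → V} (hf : ContDiffOn ℝ n f U)
    (hn : n ≠ 0) (hU : IsOpen U) (hx : x ∈ U) : DifferentiableAt ℝ f x :=
  (hf.contDiffAt (hU.mem_nhds hx)).differentiableAt hn

theorem ContDiffOn.pd {m n : ℕ∞ω} {f : Coord → V} (hf : ContDiffOn ℝ n f U) (hU : IsOpen U)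
    (hmn : m + 1 ≤ n) (k : Fin 4) : ContDiffOn ℝ m (pd k f) U :=
  (hf.fderiv_of_isOpen hU hmn).clm_apply contDiffOn_const

/-- This is where flatness enters: a general `∂ + Ω` has no such symmetry. -/
theorem pd_comm {f : Coord → V} (hf : ContDiffOn ℝ 2 f U) (hU : IsOpen U) (hx : x ∈ U)
    (i j : Fin 4) : pd i (pd j f) x = pd j (pd i f) x := by
  have hd : DifferentiableAt ℝ (fderiv ℝ f) x :=
    ((hf.fderiv_of_isOpen (m := 1) hU (by norm_num)).contDiffAt
      (hU.mem_nhds hx)).differentiableAt one_ne_zero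
  have h2 : ∀ a c : Fin 4, pd a (pd c f) x
      = fderiv ℝ (fderiv ℝ f) x (Pi.single a 1) (Pi.single c 1) := by
    intro a c
    simp only [pd.eq_def a, show pd c f = fun y => fderiv ℝ f y (Pi.single c 1) from rfl]
    rw [fderiv_clm_apply hd (differentiableAt_const _)]
    simp
  rw [h2, h2]
  exact (hf.contDiffAt (hU.mem_nhds hx)).isSymmSndFDerivAt (by simp) _ _

/-! The derivation `∂_k + Ω_k`. -/

theorem ambientDeriv_zero : ambientDeriv (fun _ _ => (0 : V →L[ℝ] V)) = pd := by
  funext k s y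
  simp [ambientDeriv]

variable (Ω : Fin 4 → Coord → (V →L[ℝ] V))

theorem ambientDeriv_congr (hU : IsOpen U) (hx : x ∈ U) {f h : Coord → V}
    (hfh : ∀ y ∈ U, f y = h y) (k : Fin 4) : ambientDeriv Ω k f x = ambientDeriv Ω k h x := by
  rw [ambientDeriv, ambientDeriv, pd_congr hU hx hfh, hfh x hx]

/-- The zeroth-order term `Ω` is linear over functions, so the Leibniz rule survives. Together with
`ambientDeriv_congr` it is all that the frame computations need. -/
theorem ambientDeriv_sum_smul {ι : Type*} [Fintype ι] {c : ι → Coord → ℝ} {f : ι → Coord → V}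
    (hc : ∀ i, DifferentiableAt ℝ (c i) x) (hf : ∀ i, DifferentiableAt ℝ (f i) x) (k : Fin 4) :
    ambientDeriv Ω k (fun y => ∑ i, c i y • f i y) x
      = ∑ i, (pd k (c i) x • f i x + c i x • ambientDeriv Ω k (f i) x) := by
  simp only [ambientDeriv, pd_sum_smul hc hf, map_sum, map_smul, ← Finset.sum_add_distrib]
  exact Finset.sum_congr rfl fun i _ => by module

end Calculus

/-! ### Inverse metric and Christoffel symbols. -/

section Metric

variable {p q : ℕ} {U : Set Coord} {x : Coord} {g : Coord → Matrix (Fin 4) (Fin 4) ℝ}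
  {b : Fin 4 → Fin 4 → NIdx p q → Coord → ℝ}
  {A : Fin 4 → NIdx p q → NIdx p q → Coord → ℝ}

/-- With `IsLorentzian.isUnit_det`, this is all that is drawn from the signature of `g`. -/
theorem IsLorentzian.isSymm {G : Matrix (Fin 4) (Fin 4) ℝ} (h : IsLorentzian G) :
    G.IsSymm := by
  obtain ⟨P, -, rfl⟩ := h
  simp [Matrix.IsSymm, Matrix.transpose_mul, Matrix.mul_assoc]

theorem IsLorentzian.isUnit_det {G : Matrix (Fin 4) (Fin 4) ℝ} (h : IsLorentzian G) :
    IsUnit G.det := by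
  obtain ⟨P, hP, rfl⟩ := h
  rw [Matrix.det_mul, Matrix.det_mul, Matrix.det_transpose, Matrix.det_diagonal]
  refine (hP.mul ?_).mul hP
  simp [Fin.prod_univ_four]

theorem contDiffOn_det {n : ℕ∞ω} {ι : Type*} [Fintype ι] [DecidableEq ι]
    {G : Coord → Matrix ι ι ℝ}
    (hG : ∀ i j, ContDiffOn ℝ n (fun y => G y i j) U) : ContDiffOn ℝ n (fun y => (G y).det) U := by
  simp only [Matrix.det_apply]
  refine ContDiffOn.sum fun σ _ => ContDiffOn.const_smul _ ?_
  exact contDiffOn_prod fun i _ => hG _ _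

/-- Cramer's rule: adjugate entries are determinants of `G` with one row replaced by a constant unit
vector. -/
theorem contDiffOn_matrix_inv {n : ℕ∞ω} {ι : Type*} [Fintype ι] [DecidableEq ι]
    {G : Coord → Matrix ι ι ℝ}
    (hG : ∀ i j, ContDiffOn ℝ n (fun y => G y i j) U) (hdet : ∀ y ∈ U, IsUnit (G y).det)
    (i j : ι) : ContDiffOn ℝ n (fun y => (G y)⁻¹ i j) U := by
  simp only [Matrix.inv_def, Matrix.smul_apply, Ring.inverse_eq_inv', smul_eq_mul,
    Matrix.adjugate_apply]
  refine ((contDiffOn_det hG).inv fun y hy => (hdet y hy).ne_zero).mul (contDiffOn_det ?_)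
  intro a c
  by_cases h : a = j
  · subst h; simp only [Matrix.updateRow_self]; exact contDiffOn_const
  · simp only [Matrix.updateRow_ne h]; exact hG a c

namespace IsSpacetimeData

theorem symm_g (hdata : IsSpacetimeData U g b A) (hx : x ∈ U) (i j : Fin 4) :
    g x i j = g x j i := ((hdata.lorentzian x hx).isSymm.apply i j).symm

theorem symm_inv (hdata : IsSpacetimeData U g b A) (hx : x ∈ U) (i j : Fin 4) :
    (g x)⁻¹ i j = (g x)⁻¹ j i := by
  conv_lhs => rw [← (hdata.lorentzian x hx).isSymm.eq, ← Matrix.transpose_nonsing_inv,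
    Matrix.transpose_apply]

theorem inv_mul_g (hdata : IsSpacetimeData U g b A) (hx : x ∈ U) : (g x)⁻¹ * g x = 1 :=
  Matrix.nonsing_inv_mul _ (hdata.lorentzian x hx).isUnit_det

theorem g_mul_inv (hdata : IsSpacetimeData U g b A) (hx : x ∈ U) : g x * (g x)⁻¹ = 1 :=
  Matrix.mul_nonsing_inv _ (hdata.lorentzian x hx).isUnit_det

theorem smooth_inv (hdata : IsSpacetimeData U g b A) (i j : Fin 4) :
    ContDiffOn ℝ ∞ (fun y => (g y)⁻¹ i j) U :=
  contDiffOn_matrix_inv hdata.smooth_g (fun y hy => (hdata.lorentzian y hy).isUnit_det) i j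

theorem smooth_christoffel (hdata : IsSpacetimeData U g b A) (hU : IsOpen U) (n i j : Fin 4) :
    ContDiffOn ℝ ∞ (christoffel g n i j) U := by
  have h : ∀ k i j, ContDiffOn ℝ ∞ (pd k (fun y => g y i j)) U := fun k i j =>
    (hdata.smooth_g i j).pd hU (by simp) k
  unfold christoffel
  exact contDiffOn_const.mul (ContDiffOn.sum fun m _ =>
    (hdata.smooth_inv n m).mul (((h _ _ _).add (h _ _ _)).sub (h _ _ _)))

theorem pd_g_symm (hdata : IsSpacetimeData U g b A) (hU : IsOpen U) (hx : x ∈ U)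
    (k i j : Fin 4) : pd k (fun y => g y i j) x = pd k (fun y => g y j i) x :=
  pd_congr hU hx (fun _ hy => hdata.symm_g hy i j) k

theorem christoffel_symm (hdata : IsSpacetimeData U g b A) (hU : IsOpen U) (hx : x ∈ U)
    (n i j : Fin 4) : christoffel g n i j x = christoffel g n j i x := by
  simp only [christoffel]
  congr 1
  refine Finset.sum_congr rfl fun m _ => ?_
  rw [hdata.pd_g_symm hU hx m i j]
  ring

/-- The inverse metric is covariantly constant. -/
theorem pd_inv (hdata : IsSpacetimeData U g b A) (hU : IsOpen U) (hx : x ∈ U)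
    (k m n : Fin 4) : pd k (fun y => (g y)⁻¹ m n) x
      = -∑ s, christoffel g m k s x * (g x)⁻¹ s n - ∑ s, christoffel g n k s x * (g x)⁻¹ m s := by
  have dg : ∀ i j, DifferentiableAt ℝ (fun y => g y i j) x := fun i j =>
    (hdata.smooth_g i j).differentiableAt_of_isOpen (by simp) hU hx
  have di : ∀ i j, DifferentiableAt ℝ (fun y => (g y)⁻¹ i j) x := fun i j =>
    (hdata.smooth_inv i j).differentiableAt_of_isOpen (by simp) hU hx
  -- differentiate `g⁻¹ g = 1`
  have h1 : ∀ c, ∑ a, (pd k (fun y => (g y)⁻¹ m a) x * g x a c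
      + (g x)⁻¹ m a * pd k (fun y => g y a c) x) = 0 := by
    intro c
    have e : pd k (fun y => ∑ a, (g y)⁻¹ m a * g y a c) x
        = ∑ a, (pd k (fun y => (g y)⁻¹ m a) x * g x a c
          + (g x)⁻¹ m a * pd k (fun y => g y a c) x) :=
      pd_sum_smul (di m) (fun a => dg a c) k
    rw [← e, ← pd_const (V := ℝ) (x := x) ((1 : Matrix (Fin 4) (Fin 4) ℝ) m c) k]
    refine pd_congr hU hx (fun y hy => ?_) k
    rw [← hdata.inv_mul_g hy, Matrix.mul_apply]
  -- Inserting `g g⁻¹ = 1` prepares the formula `∂g⁻¹ = -g⁻¹ (∂g) g⁻¹`.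
  have h2 : pd k (fun y => (g y)⁻¹ m n) x
      = ∑ c, (∑ a, pd k (fun y => (g y)⁻¹ m a) x * g x a c) * (g x)⁻¹ c n := by
    simp only [Finset.sum_mul, mul_assoc]
    rw [Finset.sum_comm]
    simp only [← Finset.mul_sum, ← Matrix.mul_apply, hdata.g_mul_inv hx, Matrix.one_apply,
      mul_ite, mul_one, mul_zero, Finset.sum_ite_eq', Finset.mem_univ, if_true]
  have h3 : ∀ c, ∑ a, pd k (fun y => (g y)⁻¹ m a) x * g x a c
      = -∑ a, (g x)⁻¹ m a * pd k (fun y => g y a c) x := by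
    intro c
    have := h1 c
    rw [Finset.sum_add_distrib] at this
    linarith
  rw [h2]
  simp only [h3, christoffel, hdata.symm_inv hx n]
  -- Everything is now a polynomial in entries of `g⁻¹` and first derivatives of `g`; the symmetry
  -- rewrites align the index orders so that `ring` can compare both sides.
  simp only [Fin.sum_univ_four, hdata.pd_g_symm hU hx k 1 0, hdata.pd_g_symm hU hx k 2 0,
    hdata.pd_g_symm hU hx k 3 0, hdata.pd_g_symm hU hx k 2 1, hdata.pd_g_symm hU hx k 3 1,
    hdata.pd_g_symm hU hx k 3 2, hdata.pd_g_symm hU hx _ 0 k, hdata.pd_g_symm hU hx _ 1 k,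
    hdata.pd_g_symm hU hx _ 2 k, hdata.pd_g_symm hU hx _ 3 k]
  ring

end IsSpacetimeData

end Metric

/-! ### Commutators on a frame from the Gauss–Weingarten equations. -/

section Commutators

theorem sum_smul_sum_smul {R V ι κ : Type*} [CommSemiring R] [AddCommMonoid V] [Module R V]
    [Fintype ι] [Fintype κ] (c : ι → R) (d : ι → κ → R) (v : κ → V) :
    ∑ i, c i • ∑ j, d i j • v j = ∑ j, (∑ i, c i * d i j) • v j := by
  simp only [Finset.smul_sum, smul_smul, Finset.sum_smul]
  exact Finset.sum_comm

variable {p q : ℕ} {U : Set Coord} {x : Coord} {g : Coord → Matrix (Fin 4) (Fin 4) ℝ}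
  {b : Fin 4 → Fin 4 → NIdx p q → Coord → ℝ}
  {A : Fin 4 → NIdx p q → NIdx p q → Coord → ℝ}
  {V : Type} [NormedAddCommGroup V] [NormedSpace ℝ V]

namespace IsSpacetimeData

theorem pd_b_symm (hdata : IsSpacetimeData U g b A) (hU : IsOpen U) (hx : x ∈ U)
    (k i j : Fin 4) (M : NIdx p q) : pd k (b i j M) x = pd k (b j i M) x :=
  pd_congr hU hx (fun _ hy => hdata.symm_b _ hy i j M) k

theorem covb_symm (hdata : IsSpacetimeData U g b A) (hU : IsOpen U) (hx : x ∈ U)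
    (k i j : Fin 4) (M : NIdx p q) : covb g b k i j M x = covb g b k j i M x := by
  simp only [covb, hdata.pd_b_symm hU hx k i j, hdata.symm_b x hx i, hdata.symm_b x hx _ j]
  ring

theorem twbComp_symm (hdata : IsSpacetimeData U g b A) (hU : IsOpen U) (hx : x ∈ U)
    (k i j : Fin 4) (M : NIdx p q) : twbComp g b A k i j M x = twbComp g b A k j i M x := by
  simp only [twbComp, hdata.covb_symm hU hx k i j, hdata.symm_b x hx i j]

variable {Ω : Fin 4 → Coord → (V →L[ℝ] V)} {T : Fin 4 → Coord → V} {N : NIdx p q → Coord → V}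

theorem ambientDeriv_tangent (hGW : GaussWeingarten U (ambientDeriv Ω) g b A T N) (hx : x ∈ U)
    (j i : Fin 4) : ambientDeriv Ω j (T i) x
      = ∑ M, (eps M * b i j M x) • N M x + ∑ n, christoffel g n j i x • T n x := by
  rw [← (hGW x hx).1 i j, lcDeriv, sub_add_cancel]

/-- Differentiating `b_ijM N_M` and inserting Weingarten: derivatives of `b`, Christoffel terms and
`A` assemble into `D_k b_ij`, and the tangential part of `∇N` gives the quadratic term. -/
theorem lcDeriv2_eq (hdata : IsSpacetimeData U g b A) (hU : IsOpen U) (hx : x ∈ U)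
    (hN : ∀ M, DifferentiableAt ℝ (N M) x)
    (hGW : GaussWeingarten U (ambientDeriv Ω) g b A T N) (k j i : Fin 4) :
    lcDeriv2 (ambientDeriv Ω) g T k j i x = ∑ M, (eps M * twbComp g b A k i j M x) • N M x
      - ∑ n, (∑ m, (g x)⁻¹ m n * ∑ M, eps M * (b i j M x * b k m M x)) • T n x := by
  have db : ∀ M, DifferentiableAt ℝ (b i j M) x := fun M =>
    (hdata.smooth_b i j M).differentiableAt_of_isOpen (by simp) hU hx
  have h1 : ambientDeriv Ω k (lcDeriv (ambientDeriv Ω) g T j i) x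
      = ∑ M, (eps M * pd k (b i j M) x) • N M x
        + ((∑ P, (∑ M, eps M * b i j M x * (eps P * A k M P x)) • N P x)
          - ∑ n, (∑ M, eps M * b i j M x * ∑ m, (g x)⁻¹ m n * b k m M x) • T n x) := by
    rw [ambientDeriv_congr Ω hU hx (fun y hy => (hGW y hy).1 i j) k,
      ambientDeriv_sum_smul Ω (c := fun M y => eps M * b i j M y)
        (fun M => (db M).const_mul _) hN k, Finset.sum_add_distrib]
    congr 1
    · exact Finset.sum_congr rfl fun M _ => by rw [pd_const_mul _ (db M)]
    · simp only [(hGW x hx).2, smul_add, smul_neg, Finset.sum_add_distrib,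
        Finset.sum_neg_distrib, sum_smul_sum_smul]
      abel
  rw [lcDeriv2, h1]
  simp only [(hGW x hx).1, sum_smul_sum_smul]
  have h2 : ∀ n, ∑ M, eps M * b i j M x * ∑ m, (g x)⁻¹ m n * b k m M x
      = ∑ m, (g x)⁻¹ m n * ∑ M, eps M * (b i j M x * b k m M x) := by
    intro n
    simp only [Finset.mul_sum]
    rw [Finset.sum_comm]
    exact Finset.sum_congr rfl fun _ _ => Finset.sum_congr rfl fun _ _ => by ring
  have h3 : ∀ M, eps M * twbComp g b A k i j M x
      = eps M * pd k (b i j M) x + ∑ Q, eps Q * b i j Q x * (eps M * A k Q M x)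
        - ∑ n, christoffel g n k j x * (eps M * b i n M x)
        - ∑ n, christoffel g n k i x * (eps M * b n j M x) := by
    intro M
    -- Weingarten supplies `+A_kQM`, whereas `D_k` contains `-A_kMQ`; antisymmetry of `A` reconciles
    -- them.
    have : ∑ Q, eps Q * b i j Q x * (eps M * A k Q M x)
        = -(eps M * ∑ Q, eps Q * A k M Q x * b i j Q x) := by
      rw [Finset.mul_sum, ← Finset.sum_neg_distrib]
      refine Finset.sum_congr rfl fun Q _ => ?_
      rw [hdata.antisymm_A x hx k Q M]
      ring
    rw [this, twbComp, covb, mul_sub, mul_sub, mul_sub, Finset.mul_sum, Finset.mul_sum]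
    simp only [mul_left_comm (eps M) (christoffel _ _ _ _ _)]
    ring
  simp only [h2, h3, add_smul, sub_smul, Finset.sum_add_distrib, Finset.sum_sub_distrib]
  abel

theorem lcComm_eq (hdata : IsSpacetimeData U g b A) (hU : IsOpen U) (hx : x ∈ U)
    (hN : ∀ M, DifferentiableAt ℝ (N M) x)
    (hGW : GaussWeingarten U (ambientDeriv Ω) g b A T N) (i j k : Fin 4) :
    lcComm (ambientDeriv Ω) g T k j i x
      = ∑ M, (eps M * (twbComp g b A k j i M x - twbComp g b A j k i M x)) • N M x
        - ∑ n, (∑ m, (g x)⁻¹ m n *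
            ∑ M, eps M * (b i j M x * b k m M x - b i k M x * b j m M x)) • T n x := by
  rw [lcComm, hdata.lcDeriv2_eq hU hx hN hGW, hdata.lcDeriv2_eq hU hx hN hGW]
  simp only [hdata.twbComp_symm hU hx k i j, hdata.twbComp_symm hU hx j i k, mul_sub, sub_smul,
    Finset.sum_sub_distrib]
  abel

/-- The connection term of `D_j` cancels exactly the normal part of the Weingarten equation. -/
theorem twDeriv_normal (hGW : GaussWeingarten U (ambientDeriv Ω) g b A T N) (hx : x ∈ U)
    (j : Fin 4) (B : NIdx p q) : twDeriv (ambientDeriv Ω) A N j B x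
      = ∑ n, (-∑ m, (g x)⁻¹ m n * b j m B x) • T n x := by
  rw [twDeriv, (hGW x hx).2, add_sub_cancel_right]
  simp only [neg_smul, Finset.sum_neg_distrib]

theorem twDeriv2_eq (hdata : IsSpacetimeData U g b A) (hU : IsOpen U) (hx : x ∈ U)
    (hT : ∀ i, DifferentiableAt ℝ (T i) x)
    (hGW : GaussWeingarten U (ambientDeriv Ω) g b A T N) (i j : Fin 4) (B : NIdx p q) :
    twDeriv2 (ambientDeriv Ω) g A N i j B x
      = -∑ M, (eps M * ∑ m, ∑ n, (g x)⁻¹ m n * (b j m B x * b n i M x)) • N M x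
        - ∑ n, (∑ m, (g x)⁻¹ m n * twbComp g b A i j m B x) • T n x := by
  have db : ∀ m, DifferentiableAt ℝ (b j m B) x := fun m =>
    (hdata.smooth_b j m B).differentiableAt_of_isOpen (by simp) hU hx
  have di : ∀ m n, DifferentiableAt ℝ (fun y => (g y)⁻¹ m n) x := fun m n =>
    (hdata.smooth_inv m n).differentiableAt_of_isOpen (by simp) hU hx
  have dc : ∀ n, DifferentiableAt ℝ (fun y => -∑ m, (g y)⁻¹ m n * b j m B y) x := fun n =>
    (DifferentiableAt.fun_sum fun m _ => (di m n).mul (db m)).neg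
  have pc : ∀ n, pd i (fun y => -∑ m, (g y)⁻¹ m n * b j m B y) x
      = -∑ m, (pd i (fun y => (g y)⁻¹ m n) x * b j m B x
        + (g x)⁻¹ m n * pd i (b j m B) x) := by
    intro n
    have e : pd i (fun y => ∑ m, (g y)⁻¹ m n * b j m B y) x
        = ∑ m, (pd i (fun y => (g y)⁻¹ m n) x * b j m B x + (g x)⁻¹ m n * pd i (b j m B) x) :=
      pd_sum_smul (fun m => di m n) db i
    rw [pd_neg, e]
  have h1 : ambientDeriv Ω i (twDeriv (ambientDeriv Ω) A N j B) x
      = ∑ n, (pd i (fun y => -∑ m, (g y)⁻¹ m n * b j m B y) x) • T n x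
        + (∑ M, (∑ n, (-∑ m, (g x)⁻¹ m n * b j m B x) * (eps M * b n i M x)) • N M x
          + ∑ s, (∑ n, (-∑ m, (g x)⁻¹ m n * b j m B x) * christoffel g s i n x) • T s x) := by
    rw [ambientDeriv_congr Ω hU hx (fun y hy => twDeriv_normal hGW hy j B) i,
      ambientDeriv_sum_smul Ω (c := fun n y => -∑ m, (g y)⁻¹ m n * b j m B y) dc hT i,
      Finset.sum_add_distrib]
    simp only [ambientDeriv_tangent hGW hx, smul_add, Finset.sum_add_distrib, sum_smul_sum_smul]
  have h2 : ∀ M, ∑ n, (-∑ m, (g x)⁻¹ m n * b j m B x) * (eps M * b n i M x)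
      = -(eps M * ∑ m, ∑ n, (g x)⁻¹ m n * (b j m B x * b n i M x)) := by
    intro M
    rw [Finset.sum_comm, Finset.mul_sum, ← Finset.sum_neg_distrib]
    refine Finset.sum_congr rfl fun n _ => ?_
    rw [neg_mul, Finset.sum_mul, Finset.mul_sum]
    exact congrArg _ (Finset.sum_congr rfl fun m _ => by ring)
  have h3 : ∀ n, ∑ P, eps P * A i B P x * (-∑ m, (g x)⁻¹ m n * b j m P x)
      = -∑ m, (g x)⁻¹ m n * ∑ P, eps P * A i B P x * b j m P x := by
    intro n
    simp only [Finset.mul_sum, mul_neg, Finset.sum_neg_distrib]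
    rw [Finset.sum_comm]
    exact congrArg _ (Finset.sum_congr rfl fun _ _ => Finset.sum_congr rfl fun _ _ => by ring)
  -- By `pd_inv`, one Christoffel term of `∂_i g^mn` cancels that from differentiating `T_n`; the
  -- other is the connection term of `D_i b_jm` for the index `m`.
  have h4 : ∀ n, -∑ m, (g x)⁻¹ m n * twbComp g b A i j m B x
      = pd i (fun y => -∑ m, (g y)⁻¹ m n * b j m B y) x
        + ∑ s, (-∑ m, (g x)⁻¹ m s * b j m B x) * christoffel g n i s x
        - ∑ P, eps P * A i B P x * (-∑ m, (g x)⁻¹ m n * b j m P x)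
        - ∑ s, christoffel g s i j x * (-∑ m, (g x)⁻¹ m n * b s m B x) := by
    intro n
    rw [pc, h3]
    simp only [hdata.pd_inv hU hx, twbComp, covb, Fin.sum_univ_four]
    ring
  change ambientDeriv Ω i (twDeriv (ambientDeriv Ω) A N j B) x
    - ∑ P, (eps P * A i B P x) • twDeriv (ambientDeriv Ω) A N j P x
    - ∑ n, christoffel g n i j x • twDeriv (ambientDeriv Ω) A N n B x = _
  have h5 : ∑ n, (∑ m, (g x)⁻¹ m n * twbComp g b A i j m B x) • T n x
      = -∑ n, (-∑ m, (g x)⁻¹ m n * twbComp g b A i j m B x) • T n x := by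
    simp only [neg_smul, Finset.sum_neg_distrib, neg_neg]
  rw [h1, h5]
  simp only [twDeriv_normal hGW hx, sum_smul_sum_smul, h2]
  simp only [h4, add_smul, sub_smul, Finset.sum_add_distrib, Finset.sum_sub_distrib]
  simp only [neg_smul, Finset.sum_neg_distrib]
  abel

theorem twComm_eq (hdata : IsSpacetimeData U g b A) (hU : IsOpen U) (hx : x ∈ U)
    (hT : ∀ i, DifferentiableAt ℝ (T i) x)
    (hGW : GaussWeingarten U (ambientDeriv Ω) g b A T N) (i j : Fin 4) (B : NIdx p q) :
    twComm (ambientDeriv Ω) g A N i j B x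
      = ∑ M, (eps M * ricciQuad g b i j B M x) • N M x
        - ∑ n, (∑ m, (g x)⁻¹ m n *
            (twbComp g b A i j m B x - twbComp g b A j i m B x)) • T n x := by
  have h : ∀ M, eps M * ricciQuad g b i j B M x
      = eps M * ∑ m, ∑ n, (g x)⁻¹ m n * (b i m B x * b n j M x)
        - eps M * ∑ m, ∑ n, (g x)⁻¹ m n * (b j m B x * b n i M x) := by
    intro M
    simp only [ricciQuad, mul_sub, Finset.sum_sub_distrib, hdata.symm_b x hx _ i B,
      hdata.symm_b x hx _ j B, hdata.symm_b x hx _ i M, hdata.symm_b x hx _ j M]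
  rw [twComm, hdata.twDeriv2_eq hU hx hT hGW, hdata.twDeriv2_eq hU hx hT hGW]
  simp only [h, mul_sub, sub_smul, Finset.sum_sub_distrib]
  abel

/-! ### Commutators in flat space from the symmetry of second derivatives. -/

/-- The components `F_ijMP` of the twisting curvature. -/
noncomputable def _root_.twCurvComp (A : Fin 4 → NIdx p q → NIdx p q → Coord → ℝ) (i j : Fin 4)
    (M P : NIdx p q) (x : Coord) : ℝ :=
  -(pd i (A j M P) x - pd j (A i M P) x)
    + ∑ Q, eps Q * (A i M Q x * A j Q P x - A j M Q x * A i Q P x)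

theorem twDeriv2_pd (hdata : IsSpacetimeData U g b A) (hU : IsOpen U) (hx : x ∈ U)
    {X : NIdx p q → Coord → V} (hX : ∀ M, ContDiffOn ℝ 2 (X M) U) (i j : Fin 4)
    (M : NIdx p q) :
    twDeriv2 pd g A X i j M x = pd i (pd j (X M)) x
      - ∑ P, (eps P * pd i (A j M P) x) • X P x - ∑ P, (eps P * A j M P x) • pd i (X P) x
      - ∑ P, (eps P * A i M P x) • pd j (X P) x
      + ∑ P, (∑ Q, eps Q * A i M Q x * (eps P * A j Q P x)) • X P x
      - ∑ n, christoffel g n i j x • twDeriv pd A X n M x := by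
  have dX : ∀ P, DifferentiableAt ℝ (X P) x := fun P =>
    (hX P).differentiableAt_of_isOpen two_ne_zero hU hx
  have dpX : DifferentiableAt ℝ (pd j (X M)) x :=
    ((hX M).pd (m := 1) hU (by norm_num) j).differentiableAt_of_isOpen one_ne_zero hU hx
  have dA : ∀ P, DifferentiableAt ℝ (A j M P) x := fun P =>
    (hdata.smooth_A j M P).differentiableAt_of_isOpen (by simp) hU hx
  have dA' : ∀ P, DifferentiableAt ℝ (fun y => eps P * A j M P y) x := fun P =>
    (dA P).const_mul _
  have h1 : pd i (twDeriv pd A X j M) x = pd i (pd j (X M)) x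
      - (∑ P, (eps P * pd i (A j M P) x) • X P x + ∑ P, (eps P * A j M P x) • pd i (X P) x) := by
    have e := pd_sub dpX (DifferentiableAt.fun_sum (u := Finset.univ)
      fun P _ => (dA' P).smul (dX P)) i
    refine e.trans ?_
    have e2 := pd_sum_smul dA' dX i
    rw [Finset.sum_add_distrib] at e2
    simp only [pd_const_mul _ (dA _)] at e2
    exact congrArg _ e2
  change pd i (twDeriv pd A X j M) x - ∑ P, (eps P * A i M P x) • twDeriv pd A X j P x
    - ∑ n, christoffel g n i j x • twDeriv pd A X n M x = _
  rw [h1]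
  have h2 : ∑ P, (eps P * A i M P x) • twDeriv pd A X j P x
      = ∑ P, (eps P * A i M P x) • pd j (X P) x
        - ∑ P, (∑ Q, eps Q * A i M Q x * (eps P * A j Q P x)) • X P x := by
    simp only [twDeriv, smul_sub, Finset.sum_sub_distrib, sum_smul_sum_smul]
  rw [h2]
  abel

/-- Terms with first derivatives of `X` form a sum symmetric in `i`, `j` and cancel, as do the
Christoffel terms. The value space is arbitrary: real components `X_M` and ambient normals `N_M` are
both needed. -/
theorem twComm_pd (hdata : IsSpacetimeData U g b A) (hU : IsOpen U) (hx : x ∈ U)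
    {X : NIdx p q → Coord → V} (hX : ∀ M, ContDiffOn ℝ 2 (X M) U) (i j : Fin 4)
    (M : NIdx p q) :
    twComm pd g A X i j M x = ∑ P, (eps P * twCurvComp A i j M P x) • X P x := by
  have h : ∀ P, eps P * twCurvComp A i j M P x
      = eps P * pd j (A i M P) x - eps P * pd i (A j M P) x
        + (∑ Q, eps Q * A i M Q x * (eps P * A j Q P x)
          - ∑ Q, eps Q * A j M Q x * (eps P * A i Q P x)) := by
    intro P
    rw [twCurvComp, ← Finset.sum_sub_distrib, mul_add, Finset.mul_sum]
    congr 1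
    · ring
    · exact Finset.sum_congr rfl fun Q _ => by ring
  rw [twComm, hdata.twDeriv2_pd hU hx hX, hdata.twDeriv2_pd hU hx hX, pd_comm (hX M) hU hx i j]
  simp only [h, hdata.christoffel_symm hU hx _ i j, add_smul, sub_smul, Finset.sum_add_distrib,
    Finset.sum_sub_distrib]
  abel

theorem lcDeriv2_pd (hdata : IsSpacetimeData U g b A) (hU : IsOpen U) (hx : x ∈ U)
    (hT : ∀ i, DifferentiableAt ℝ (T i) x) (k j i : Fin 4)
    (hT' : DifferentiableAt ℝ (pd j (T i)) x) :
    lcDeriv2 pd g T k j i x = pd k (pd j (T i)) x - ∑ n, pd k (christoffel g n j i) x • T n x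
      - ∑ n, christoffel g n j i x • pd k (T n) x - ∑ n, christoffel g n k i x • pd j (T n) x
      + ∑ n, (∑ s, christoffel g s k i x * christoffel g n j s x) • T n x
      - ∑ n, christoffel g n k j x • lcDeriv pd g T n i x := by
  have dΓ : ∀ n, DifferentiableAt ℝ (christoffel g n j i) x := fun n =>
    (hdata.smooth_christoffel hU n j i).differentiableAt_of_isOpen (by simp) hU hx
  have h1 : pd k (lcDeriv pd g T j i) x = pd k (pd j (T i)) x
      - (∑ n, pd k (christoffel g n j i) x • T n x
        + ∑ n, christoffel g n j i x • pd k (T n) x) := by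
    refine (pd_sub hT' (DifferentiableAt.fun_sum (u := Finset.univ)
      fun n _ => (dΓ n).smul (hT n)) k).trans ?_
    have e2 := pd_sum_smul dΓ hT k
    rw [Finset.sum_add_distrib] at e2
    exact congrArg _ e2
  have h2 : ∑ n, christoffel g n k i x • lcDeriv pd g T j n x
      = ∑ n, christoffel g n k i x • pd j (T n) x
        - ∑ n, (∑ s, christoffel g s k i x * christoffel g n j s x) • T n x := by
    simp only [lcDeriv, smul_sub, Finset.sum_sub_distrib, sum_smul_sum_smul]
  rw [lcDeriv2, h1, h2]
  abel

theorem lcComm_pd (hdata : IsSpacetimeData U g b A) (hU : IsOpen U) (hx : x ∈ U)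
    (hT : ∀ i, ContDiffOn ℝ 2 (T i) U) (k j i : Fin 4) :
    lcComm pd g T k j i x = -∑ n, (∑ m, (g x)⁻¹ m n * riemann g m i k j x) • T n x := by
  have hT0 : ∀ i, DifferentiableAt ℝ (T i) x := fun i =>
    (hT i).differentiableAt_of_isOpen two_ne_zero hU hx
  have hT1 : ∀ j, DifferentiableAt ℝ (pd j (T i)) x := fun j =>
    ((hT i).pd (m := 1) hU (by norm_num) j).differentiableAt_of_isOpen one_ne_zero hU hx
  -- The inverse metric undoes the lowering of the first index in `riemann`.
  have hR : ∀ n, ∑ m, (g x)⁻¹ m n * riemann g m i k j x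
      = pd k (christoffel g n j i) x - pd j (christoffel g n k i) x
        + (∑ s, christoffel g s j i x * christoffel g n k s x
          - ∑ s, christoffel g s k i x * christoffel g n j s x) := by
    intro n
    simp only [riemann, Finset.mul_sum, ← mul_assoc]
    rw [Finset.sum_comm]
    simp only [hdata.symm_inv hx _ n, ← Finset.sum_mul, ← Matrix.mul_apply, hdata.inv_mul_g hx,
      Matrix.one_apply, ite_mul, one_mul, zero_mul, Finset.sum_ite_eq, Finset.mem_univ, if_true,
      ← Finset.sum_sub_distrib]
    congr 1
    exact Finset.sum_congr rfl fun s _ => by ring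
  rw [lcComm, hdata.lcDeriv2_pd hU hx hT0 k j i (hT1 j),
    hdata.lcDeriv2_pd hU hx hT0 j k i (hT1 k), pd_comm (hT i) hU hx k j]
  simp only [hR, hdata.christoffel_symm hU hx _ k j, add_smul, sub_smul, Finset.sum_add_distrib,
    Finset.sum_sub_distrib]
  abel

end IsSpacetimeData

end Commutators

/-! ### Clifford forms of the equations, involutivity, and the Gauss and Ricci equations. -/

section Structure

variable {p q : ℕ} {U : Set Coord} {x : Coord} {g : Coord → Matrix (Fin 4) (Fin 4) ℝ}
  {b : Fin 4 → Fin 4 → NIdx p q → Coord → ℝ}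
  {A : Fin 4 → NIdx p q → NIdx p q → Coord → ℝ}
  {V : Type} [NormedAddCommGroup V] [NormedSpace ℝ V]
  {Ω : Fin 4 → Coord → (V →L[ℝ] V)} {T : Fin 4 → Coord → V} {N : NIdx p q → Coord → V}

theorem eps_mul_self (M : NIdx p q) : eps M * eps M = 1 := by
  rcases M with _ | _ <;> simp [eps]

theorem eps_ne_zero (M : NIdx p q) : eps M ≠ 0 :=
  left_ne_zero_of_mul_eq_one (eps_mul_self M)

theorem sum_sum_comm_sum_sum {ι κ W : Type*} [AddCommMonoid W] [Fintype ι] [Fintype κ]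
    (f : ι → ι → κ → κ → W) :
    ∑ a, ∑ b, ∑ c, ∑ d, f a b c d = ∑ c, ∑ d, ∑ a, ∑ b, f a b c d :=
  calc _ = ∑ a, ∑ c, ∑ b, ∑ d, f a b c d := Finset.sum_congr rfl fun _ _ => Finset.sum_comm
    _ = ∑ c, ∑ a, ∑ b, ∑ d, f a b c d := Finset.sum_comm
    _ = ∑ c, ∑ a, ∑ d, ∑ b, f a b c d :=
      Finset.sum_congr rfl fun _ _ => Finset.sum_congr rfl fun _ _ => Finset.sum_comm
    _ = _ := Finset.sum_congr rfl fun _ _ => Finset.sum_comm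

namespace IsSpacetimeData

theorem cComm_cA_cVec (hdata : IsSpacetimeData U g b A) (hx : x ∈ U) (k : Fin 4)
    (X : NIdx p q → ℝ) :
    cComm (cA A k x) (cVec X) = cVec (fun M => ∑ P, eps P * A k M P x * X P) :=
  cComm_spin_cVec (hdata.antisymm_A x hx k) X

theorem twb_eq (hdata : IsSpacetimeData U g b A) (hx : x ∈ U) (k i j : Fin 4) :
    twb g b A k i j x = cVec (fun M => twbComp g b A k i j M x) := by
  rw [twb, cb, hdata.cComm_cA_cVec hx, cVec_sub]
  rfl

theorem codazzi_iff (hdata : IsSpacetimeData U g b A) :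
    Codazzi U g b A ↔
      ∀ x ∈ U, ∀ i j k M, twbComp g b A j k i M x = twbComp g b A k j i M x := by
  refine forall₂_congr fun x hx => forall₃_congr fun i j k => ?_
  rw [smul_eq_zero_iff_right (by norm_num), sub_eq_zero, hdata.twb_eq hx, hdata.twb_eq hx,
    cVec_injective.eq_iff, funext_iff]

/-- The derivative part inherits antisymmetry from `A`, and the quadratic part is a commutator of
antisymmetric matrices. This is needed to let `F_ij` act on vectors through `cComm_spin_cVec`. -/
theorem twCurvComp_antisymm (hdata : IsSpacetimeData U g b A) (hU : IsOpen U) (hx : x ∈ U)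
    (i j : Fin 4) (M P : NIdx p q) : twCurvComp A i j M P x = -twCurvComp A i j P M x := by
  have hpd : ∀ k l, pd k (A l M P) x = -pd k (A l P M) x := by
    intro k l
    rw [pd_congr hU hx (fun y hy => hdata.antisymm_A y hy l M P) k, pd_neg]
  rw [twCurvComp, twCurvComp, hpd, hpd, neg_add, ← Finset.sum_neg_distrib]
  congr 1
  · ring
  · refine Finset.sum_congr rfl fun Q _ => ?_
    rw [hdata.antisymm_A x hx i M Q, hdata.antisymm_A x hx j M Q, hdata.antisymm_A x hx i Q P,
      hdata.antisymm_A x hx j Q P]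
    ring

theorem twCurv_eq (hdata : IsSpacetimeData U g b A) (hx : x ∈ U) (i j : Fin 4) :
    twCurv A i j x = spin (fun M P => twCurvComp A i j M P x) := by
  have h := cComm_spin_spin (hdata.antisymm_A x hx i) (hdata.antisymm_A x hx j)
  change -(_ - cComm (spin fun M P => A i M P x) (spin fun M P => A j M P x)) = _
  rw [h, neg_sub, sub_eq_neg_add]
  simp only [spin, twCurvComp, add_smul, neg_smul, Finset.sum_add_distrib,
    Finset.sum_neg_distrib]

/-- Exchanging the summation indices `m`, `n`, under which `g^mn` is symmetric, exchanges the two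
products. -/
theorem ricciQuad_antisymm (hdata : IsSpacetimeData U g b A) (hx : x ∈ U) (i j : Fin 4)
    (M P : NIdx p q) : ricciQuad g b i j M P x = -ricciQuad g b i j P M x := by
  rw [ricciQuad, Finset.sum_comm, ricciQuad]
  simp only [← Finset.sum_neg_distrib]
  refine Finset.sum_congr rfl fun m _ => Finset.sum_congr rfl fun n _ => ?_
  rw [hdata.symm_inv hx n m]
  simp only [hdata.symm_b x hx n, hdata.symm_b x hx m]
  ring

theorem spin_ricciQuad (hdata : IsSpacetimeData U g b A) (hx : x ∈ U) (i j : Fin 4) :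
    spin (fun M P => ricciQuad g b i j M P x) = (1 / 4 : ℝ) • ∑ m, ∑ n,
      (g x)⁻¹ m n • (cb b m i x * cb b j n x - cb b m j x * cb b i n x) := by
  rw [spin_eq (hdata.ricciQuad_antisymm hx i j)]
  congr 1
  have h : ∀ m n, (g x)⁻¹ m n • (cb b m i x * cb b j n x - cb b m j x * cb b i n x)
      = ∑ M, ∑ P, ((g x)⁻¹ m n * (b m i M x * b j n P x - b m j M x * b i n P x))
        • (cE M * cE P) := by
    intro m n
    simp only [cb, cVec_mul_cVec, ← Finset.sum_sub_distrib, ← sub_smul, Finset.smul_sum,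
      smul_smul]
  simp only [h, ricciQuad, Finset.sum_smul]
  exact sum_sum_comm_sum_sum _

end IsSpacetimeData

/-! ### Comparison of coefficients in a frame -/

theorem IsFrame.differentiableAt_tangent (hF : IsFrame U T N) (hU : IsOpen U) (hx : x ∈ U)
    (i : Fin 4) : DifferentiableAt ℝ (T i) x :=
  (hF.smooth_T i).differentiableAt_of_isOpen (by simp) hU hx

theorem IsFrame.differentiableAt_normal (hF : IsFrame U T N) (hU : IsOpen U) (hx : x ∈ U)
    (M : NIdx p q) : DifferentiableAt ℝ (N M) x :=
  (hF.smooth_N M).differentiableAt_of_isOpen (by simp) hU hx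

theorem IsFrame.eq_zero (hF : IsFrame U T N) (hx : x ∈ U) {a : NIdx p q → ℝ} {c : Fin 4 → ℝ}
    (h : ∑ M, a M • N M x + ∑ n, c n • T n x = 0) : (∀ M, a M = 0) ∧ ∀ n, c n = 0 := by
  have := Fintype.linearIndependent_iff.1 (hF.indep x hx) (Sum.elim c a)
    (by rw [Fintype.sum_sum_type, add_comm]; simpa using h)
  exact ⟨fun M => this (Sum.inr M), fun n => this (Sum.inl n)⟩

theorem IsFrame.normal_coeff_eq_zero (hF : IsFrame U T N) (hx : x ∈ U) {a : NIdx p q → ℝ}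
    {c d : Fin 4 → ℝ} (h : ∑ M, a M • N M x - ∑ n, c n • T n x = ∑ n, d n • T n x) (M : NIdx p q) :
    a M = 0 := by
  refine (hF.eq_zero hx (a := a) (c := fun n => -(c n + d n)) ?_).1 M
  simp only [neg_smul, add_smul, Finset.sum_neg_distrib, Finset.sum_add_distrib, ← h]
  abel

theorem IsFrame.tangent_coeff_eq_zero (hF : IsFrame U T N) (hx : x ∈ U) {a d : NIdx p q → ℝ}
    {c : Fin 4 → ℝ} (h : ∑ M, a M • N M x - ∑ n, c n • T n x = ∑ M, d M • N M x) (n : Fin 4) :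
    c n = 0 := by
  rw [← neg_eq_zero]
  refine (hF.eq_zero hx (a := fun M => a M - d M) (c := fun n => -c n) ?_).2 n
  simp only [neg_smul, sub_smul, Finset.sum_neg_distrib, Finset.sum_sub_distrib, ← h]
  abel

theorem IsFrame.normal_ext (hF : IsFrame U T N) (hx : x ∈ U) {a d : NIdx p q → ℝ}
    (h : ∑ M, a M • N M x = ∑ M, d M • N M x) (M : NIdx p q) : a M = d M := by
  rw [← sub_eq_zero]
  refine (hF.eq_zero hx (a := fun M => a M - d M) (c := 0) ?_).1 M
  simp [sub_smul, h]

theorem IsFrame.tangent_ext (hF : IsFrame U T N) (hx : x ∈ U) {c d : Fin 4 → ℝ}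
    (h : ∑ n, c n • T n x = ∑ n, d n • T n x) (n : Fin 4) : c n = d n := by
  rw [← sub_eq_zero]
  refine (hF.eq_zero hx (a := 0) (c := fun n => c n - d n) ?_).2 n
  simp [sub_smul, h]

namespace IsSpacetimeData

/-- The inverse metric raises indices injectively. -/
theorem eq_of_sum_inv_mul_eq (hdata : IsSpacetimeData U g b A) (hx : x ∈ U) {u v : Fin 4 → ℝ}
    (h : ∀ n, ∑ m, (g x)⁻¹ m n * u m = ∑ m, (g x)⁻¹ m n * v m) : u = v := by
  have h' : Matrix.vecMul u (g x)⁻¹ = Matrix.vecMul v (g x)⁻¹ := by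
    funext n
    simpa only [Matrix.vecMul, dotProduct, mul_comm] using h n
  have := congrArg (fun w => Matrix.vecMul w (g x)) h'
  simpa only [Matrix.vecMul_vecMul, hdata.inv_mul_g hx, Matrix.vecMul_one] using this

/-- The commutator is tangential exactly when its normal coefficients vanish, and these are the
Codazzi tensor times `eps`. Conversely, the remaining tangential coefficients serve as `φ`. -/
theorem isInvolutive_lcComm_iff (hdata : IsSpacetimeData U g b A) (hU : IsOpen U)
    (hF : IsFrame U T N) (hGW : GaussWeingarten U (ambientDeriv Ω) g b A T N) :
    IsInvolutive U (lcComm (ambientDeriv Ω) g T) T ↔ Codazzi U g b A := by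
  rw [hdata.codazzi_iff]
  constructor
  · rintro ⟨φ, hφ⟩ x hx i j k M
    have h := hφ x hx j k i
    rw [hdata.lcComm_eq hU hx (hF.differentiableAt_normal hU hx) hGW] at h
    have := hF.normal_coeff_eq_zero hx h M
    rwa [mul_eq_zero, or_iff_right (eps_ne_zero M), sub_eq_zero] at this
  · intro hC
    refine ⟨fun n k j i x => -∑ m, (g x)⁻¹ m n *
      ∑ M, eps M * (b i j M x * b k m M x - b i k M x * b j m M x), fun x hx k j i => ?_⟩
    rw [hdata.lcComm_eq hU hx (hF.differentiableAt_normal hU hx) hGW]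
    simp [hC x hx i k j]

theorem isInvolutive_twComm_iff (hdata : IsSpacetimeData U g b A) (hU : IsOpen U)
    (hF : IsFrame U T N) (hGW : GaussWeingarten U (ambientDeriv Ω) g b A T N) :
    IsInvolutive U (twComm (ambientDeriv Ω) g A N) N ↔ Codazzi U g b A := by
  rw [hdata.codazzi_iff]
  constructor
  · rintro ⟨φ, hφ⟩ x hx i j k B
    have h := hφ x hx j k B
    rw [hdata.twComm_eq hU hx (hF.differentiableAt_tangent hU hx) hGW] at h
    -- Here the Codazzi tensor appears only with an index raised, so nondegeneracy of the metric is
    -- needed to conclude.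
    have h0 := hdata.eq_of_sum_inv_mul_eq hx
      (u := fun m => twbComp g b A j k m B x - twbComp g b A k j m B x) (v := 0)
      (fun n => by simpa using hF.tangent_coeff_eq_zero hx h n)
    exact sub_eq_zero.1 (congrFun h0 i)
  · intro hC
    refine ⟨fun M i j B x => eps M * ricciQuad g b i j B M x, fun x hx i j B => ?_⟩
    rw [hdata.twComm_eq hU hx (hF.differentiableAt_tangent hU hx) hGW]
    simp [hC x hx _ i j]

end IsSpacetimeData

/-! ### Embedded space-times -/

section Embedded

theorem ambientInner_sum_left {ι : Type*} (s : Finset ι) (c : ι → ℝ) (u : ι → Ambient p q)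
    (v : Ambient p q) :
    ambientInner (∑ i ∈ s, c i • u i) v = ∑ i ∈ s, c i * ambientInner (u i) v := by
  simp only [ambientInner, Finset.sum_apply, Pi.smul_apply, smul_eq_mul, Finset.sum_mul,
    mul_sub, Finset.sum_sub_distrib, Finset.mul_sum, mul_assoc]
  congr 1 <;> exact Finset.sum_comm

theorem ambientInner_add_left (u v w : Ambient p q) :
    ambientInner (u + v) w = ambientInner u w + ambientInner v w := by
  simp only [ambientInner, Pi.add_apply, add_mul, Finset.sum_add_distrib]
  ring

theorem ambientInner_comm (u v : Ambient p q) : ambientInner u v = ambientInner v u := by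
  simp only [ambientInner, mul_comm]

/-- The Gram matrix of the frame is block diagonal with invertible blocks `g` and `diag(eps)`, so
pairing a linear relation with each frame vector kills its coefficients. Isometry and orthonormality
are used only here. -/
theorem IsEmbeddedSpacetime.isFrame (hdata : IsSpacetimeData U g b A) (hU : IsOpen U)
    {Y : Coord → Ambient p q} {N : NIdx p q → Coord → Ambient p q}
    (hY : IsEmbeddedSpacetime U g b A Y N) : IsFrame U (fun i => pd i Y) N where
  smooth_T i := hY.smooth_Y.pd hU (by simp) i
  smooth_N := hY.smooth_N
  indep x hx := by
    rw [Fintype.linearIndependent_iff]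
    intro c hc
    rw [Fintype.sum_sum_type] at hc
    simp only [Sum.elim_inl, Sum.elim_inr] at hc
    have hinner : ∀ v : Ambient p q, ∑ i, c (Sum.inl i) * ambientInner (pd i Y x) v
        + ∑ M, c (Sum.inr M) * ambientInner (N M x) v = 0 := by
      intro v
      have := congrArg (fun w => ambientInner w v) hc
      simp only [ambientInner_add_left, ambientInner_sum_left] at this
      rw [this]
      simp [ambientInner]
    rintro (i | M)
    · have h : Matrix.vecMul (fun i => c (Sum.inl i)) (g x) = 0 := by
        funext j
        have := hinner (pd j Y x)
        simp only [ambientInner_comm (N _ x), hY.normal x hx, mul_zero, Finset.sum_const_zero,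
          add_zero, hY.isometric x hx] at this
        exact this
      have := congrArg (fun w => Matrix.vecMul w (g x)⁻¹) h
      simp only [Matrix.vecMul_vecMul, hdata.g_mul_inv hx, Matrix.vecMul_one,
        Matrix.zero_vecMul] at this
      exact congrFun this i
    · have := hinner (N M x)
      simp only [hY.normal x hx, mul_zero, Finset.sum_const_zero, zero_add,
        hY.orthonormal x hx, mul_ite, Finset.sum_ite_eq', Finset.mem_univ, if_true] at this
      exact (mul_eq_zero.1 this).resolve_right (eps_ne_zero M)

end Embedded

namespace IsSpacetimeData

theorem gaussEq (hdata : IsSpacetimeData U g b A) (hU : IsOpen U) (hF : IsFrame U T N)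
    (h : ∀ x ∈ U, ∀ i j k, lcComm pd g T k j i x =
      -∑ n, (∑ m, (g x)⁻¹ m n *
        ∑ M, eps M * (b i j M x * b k m M x - b i k M x * b j m M x)) • T n x) :
    GaussEq U g b := by
  intro x hx i j k l
  have hcomp : riemann g i j k l x = gaussQuad b i j k l x := by
    -- With this index order `lcComm_pd` yields `R_mjkl`; lowering the remaining index then gives `m
    -- = i`.
    have h1 := h x hx j l k
    rw [hdata.lcComm_pd hU hx (fun i => (hF.smooth_T i).of_le (WithTop.coe_le_coe.2 le_top)),
      neg_inj] at h1
    have h2 := congrFun (hdata.eq_of_sum_inv_mul_eq hx (hF.tangent_ext hx h1)) i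
    rw [h2, gaussQuad]
    refine Finset.sum_congr rfl fun M _ => ?_
    rw [hdata.symm_b x hx k i, hdata.symm_b x hx l i]
    ring
  refine ⟨hcomp, ?_⟩
  rw [hcomp, cb, cb, cb, cb, cVec_mul_cVec_add_swap, cVec_mul_cVec_add_swap, smul_smul,
    smul_smul, ← sub_smul]
  congr 1
  simp only [gaussQuad, mul_sub, Finset.sum_sub_distrib]
  ring

/-- Both evaluations of the commutator are purely normal, so independence of the `N_M` identifies
`F_ijMP` with the quadratic expression. -/
theorem ricciEq (hdata : IsSpacetimeData U g b A) (hU : IsOpen U) (hF : IsFrame U T N)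
    (h : ∀ x ∈ U, ∀ i j B, twComm pd g A N i j B x =
      ∑ M, (eps M * ricciQuad g b i j B M x) • N M x) :
    RicciEq U g b A := by
  intro x hx i j
  have hcomp : ∀ M P, twCurvComp A i j M P x = ricciQuad g b i j M P x := by
    intro M P
    have h1 := h x hx i j M
    rw [hdata.twComm_pd hU hx (fun M => (hF.smooth_N M).of_le (WithTop.coe_le_coe.2 le_top))] at h1
    exact mul_left_cancel₀ (eps_ne_zero P) (hF.normal_ext hx h1 P)
  have hs : twCurv A i j x = spin (fun M P => ricciQuad g b i j M P x) := by
    rw [hdata.twCurv_eq hx]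
    simp only [hcomp]
  exact ⟨hs, hs.trans (hdata.spin_ricciQuad hx i j)⟩

end IsSpacetimeData

end Structure

theorem lemma1 (p q : ℕ) (hp : 3 ≤ p) (hq : 1 ≤ q) (U : Set Coord) (hU : IsOpen U)
    (g : Coord → Matrix (Fin 4) (Fin 4) ℝ)
    (b : Fin 4 → Fin 4 → NIdx p q → Coord → ℝ)
    (A : Fin 4 → NIdx p q → NIdx p q → Coord → ℝ)
    (hdata : IsSpacetimeData U g b A) :
    -- the twisting derivative and Codazzi's equation in components and in the Clifford algebra
    ((∀ (X : NIdx p q → Coord → ℝ), ∀ x ∈ U, ∀ k,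
        cVec (fun M => twDeriv pd A X k M x) =
          cVec (fun M => pd k (X M) x) - cComm (cA A k x) (cVec (fun M => X M x))) ∧
      (∀ x ∈ U, ∀ k i j, twb g b A k i j x = cVec (fun M => twbComp g b A k i j M x)) ∧
      (Codazzi U g b A ↔
        ∀ x ∈ U, ∀ i j k M, twbComp g b A j k i M x = twbComp g b A k j i M x) ∧
      (∀ (X : NIdx p q → Coord → ℝ), (∀ M, ContDiffOn ℝ 2 (X M) U) → ∀ x ∈ U, ∀ i j,
        cVec (fun M => twComm pd g A X i j M x) =
          cComm (twCurv A i j x) (cVec (fun M => X M x)))) ∧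
    -- consequences of the Gauss-Weingarten equations, for any ambient connection `∂ + Ω`
    (∀ (Ω : Fin 4 → Coord → (Ambient p q →L[ℝ] Ambient p q))
        (T : Fin 4 → Coord → Ambient p q) (N : NIdx p q → Coord → Ambient p q),
      IsFrame U T N → GaussWeingarten U (ambientDeriv Ω) g b A T N →
      (∀ x ∈ U, ∀ i j k, lcComm (ambientDeriv Ω) g T k j i x =
        ∑ M, (eps M * (twbComp g b A k j i M x - twbComp g b A j k i M x)) • N M x
          - ∑ n, (∑ m, (g x)⁻¹ m n *
              ∑ M, eps M * (b i j M x * b k m M x - b i k M x * b j m M x)) • T n x) ∧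
      (∀ x ∈ U, ∀ i j B, twComm (ambientDeriv Ω) g A N i j B x =
        ∑ M, (eps M * ricciQuad g b i j B M x) • N M x
          - ∑ n, (∑ m, (g x)⁻¹ m n *
              (twbComp g b A i j m B x - twbComp g b A j i m B x)) • T n x) ∧
      (IsInvolutive U (lcComm (ambientDeriv Ω) g T) T ↔ Codazzi U g b A) ∧
      (IsInvolutive U (twComm (ambientDeriv Ω) g A N) N ↔ Codazzi U g b A)) ∧
    -- space-times embedded in the flat space `M_D(p,q)`
    (∀ (Y : Coord → Ambient p q) (N : NIdx p q → Coord → Ambient p q),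
      IsEmbeddedSpacetime U g b A Y N →
      (IsInvolutive U (lcComm pd g (fun i => pd i Y)) (fun i => pd i Y) ↔ Codazzi U g b A) ∧
      (IsInvolutive U (twComm pd g A N) N ↔ Codazzi U g b A) ∧
      (Codazzi U g b A →
        (∀ x ∈ U, ∀ i j k, lcComm pd g (fun i => pd i Y) k j i x =
          - ∑ n, (∑ m, (g x)⁻¹ m n *
              ∑ M, eps M * (b i j M x * b k m M x - b i k M x * b j m M x)) • pd n Y x) ∧
        (∀ x ∈ U, ∀ i j B, twComm pd g A N i j B x =
          ∑ M, (eps M * ricciQuad g b i j B M x) • N M x) ∧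
        GaussEq U g b ∧ RicciEq U g b A)) := by

  refine ⟨⟨fun X x hx k => ?_, fun x hx k i j => hdata.twb_eq hx k i j, hdata.codazzi_iff,
    fun X hX x hx i j => ?_⟩, fun Ω T N hF hGW =>
      ⟨fun x hx => hdata.lcComm_eq hU hx (hF.differentiableAt_normal hU hx) hGW,
      fun x hx => hdata.twComm_eq hU hx (hF.differentiableAt_tangent hU hx) hGW,
      hdata.isInvolutive_lcComm_iff hU hF hGW, hdata.isInvolutive_twComm_iff hU hF hGW⟩,
    fun Y N hY => ?_⟩
  · rw [hdata.cComm_cA_cVec hx, cVec_sub]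
    rfl
  · rw [hdata.twCurv_eq hx, cComm_spin_cVec (hdata.twCurvComp_antisymm hU hx i j)]
    congr 1
    funext M
    exact hdata.twComm_pd hU hx hX i j M
  · have hF := hY.isFrame hdata hU
    -- The flat derivative is the case `Ω = 0`, so the results for a general ambient connection
    -- apply.
    have hGW : GaussWeingarten U (ambientDeriv fun _ _ => 0) g b A (fun i => pd i Y) N := by
      rw [ambientDeriv_zero]
      exact hY.gaussWeingarten
    have hlc := fun x (hx : x ∈ U) =>
      hdata.lcComm_eq hU hx (hF.differentiableAt_normal hU hx) hGW
    have htw := fun x (hx : x ∈ U) =>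
      hdata.twComm_eq hU hx (hF.differentiableAt_tangent hU hx) hGW
    have hlci := hdata.isInvolutive_lcComm_iff hU hF hGW
    have htwi := hdata.isInvolutive_twComm_iff hU hF hGW
    rw [ambientDeriv_zero] at hlci htwi
    simp only [ambientDeriv_zero] at hlc htw
    refine ⟨hlci, htwi, fun hC => ?_⟩
    rw [hdata.codazzi_iff] at hC
    have hlc' : ∀ x ∈ U, ∀ i j k, lcComm pd g (fun i => pd i Y) k j i x =
        -∑ n, (∑ m, (g x)⁻¹ m n *
          ∑ M, eps M * (b i j M x * b k m M x - b i k M x * b j m M x)) • pd n Y x := by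
      intro x hx i j k
      rw [hlc x hx]
      simp [hC x hx i k j]
    have htw' : ∀ x ∈ U, ∀ i j B, twComm pd g A N i j B x =
        ∑ M, (eps M * ricciQuad g b i j B M x) • N M x := by
      intro x hx i j B
      rw [htw x hx]
      simp [hC x hx _ i j]
    exact ⟨hlc', htw', hdata.gaussEq hU hF hlc', hdata.ricciEq hU hF htw'⟩
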